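/- Let $\mathcal{I}$ (customer classes) and $\mathcal{J}$ (server pools) be finite sets, and let $\mathcal{G}$ be a bipartite graph on $\mathcal{I}\cup\mathcal{J}$ that is a tree; write $i\sim j$ if class $i\in\mathcal{I}$ and pool $j\in\mathcal{J}$ are joined by an edge, and $\mathcal{J}(i)=\{j: j\sim i\}$. Let $\lambda_i>0$, $\nu_j>0$, $\mu_{ij}>0$ ($i\sim j$) and $\hat\lambda_i,\hat\mu_{ij},\hat\nu_j\in\mathbb{R}$ be the limiting first- and second-order parameters (arrival rates, pool sizes, service rates) of a multiclass multi-pool network in the Halfin–Whitt regime. Assume complete resource pooling: the linear program of minimizing $\max_{j}\sum_i\xi_{ij}$ over $\xi\ge 0$ with $\xi_{ij}=0$ for $i\nsim j$ and $\sum_j\mu_{ij}\nu_j\xi_{ij}=\lambda_i$ for all $i$ has a unique solution $\xi^*$, and $\sum_i\xi^*_{ij}=1$ for all $j$, $\xi^*_{ij}>0$ for all $i\sim j$. Let $h_i=\hat\lambda_i-\sum_{j\in\mathcal{J}(i)}(\mu_{ij}\xi^*_{ij}\hat\nu_j+\hat\mu_{ij}\xi^*_{ij}\nu_j)$. For $\alpha\in\mathbb{R}^{\mathcal{I}}$,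 $\beta\in\mathbb{R}^{\mathcal{J}}$ with $\sum_i\alpha_i=\sum_j\beta_j$ let $\Psi(\alpha,\beta)$ be the unique matrix with $\Psi_{ij}=0$ for $i\nsim j$, row sums $\sum_j\Psi_{ij}=\alpha_i$ and column sums $\sum_i\Psi_{ij}=\beta_j$. Let $e$ denote the vector of ones and $s^{\pm}$ the positive and negative parts of $s\in\mathbb R$. The drift of the limiting controlled diffusion is $$b_i(x,u)=h_i-\sum_{j\in\mathcal{J}(i)}\mu_{ij}\Psi_{ij}\bigl(x-\langle e,x\rangle^+u^c,\,-\langle e,x\rangle^-u^s\bigr),$$ for $x\in\mathbb{R}^{\mathcal{I}}$ and $u=(u^c,u^s)$ a pair of probability vectors on $\mathcal{I}$ and $\mathcal{J}$. Fix any pool $\hat\jmath\in\mathcal{J}$. Then there is exactly one pair of real matrices $B_1$ (of size $\mathcal{I}\times\mathcal{I}$) and $B_2$ (of size $\mathcal{I}\times\mathcal{J}$) such that the column of $B_2$ at $\hat\jmath$ is zero and $$b(x,u)=h-B_1\bigl(x-\langle e,x\rangle^+u^c\bigr)+\langle e,x\rangle^-B_2u^s\qquad\text{for all }x,u.$$ The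 matrix $B_1$ is invertible, and $$\mathfrak{d}(i,\ell)=\frac{(e^{\mathsf T}B_1^{-1})_\ell}{(e^{\mathsf T}B_1^{-1})_i}\qquad\text{for all } i,\ell\in\mathcal{I},$$ where the gain is $\mathfrak{d}(i,\ell)=\prod_{k=1}^{m-1}\frac{\mu_{i_kj_k}}{\mu_{i_{k+1}j_k}}$ over the unique path $(i_1,j_1,i_2,\dots,j_{m-1},i_m)$ in $\mathcal{G}$ from $i=i_1$ to $\ell=i_m$ (so $\mathfrak{d}(i,i)=1$). Moreover, $(e^{\mathsf T}B_1^{-1})_i>0$ for all $i\in\mathcal{I}$. -/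

import Mathlib

open scoped Matrix

noncomputable section

/-- The limiting parameters of a multiclass multi-pool network with set of customer classes `ι`
and set of server pools `κ`. -/
structure NetworkData (ι κ : Type*) where
  /-- `serves i j` : pool `j` can serve class `i`, that is, `i ∼ j`. -/
  serves : ι → κ → Prop
  /-- limiting arrival rates `λ i` -/
  lam : ι → ℝ
  /-- limiting service rates `μ i j` (meaningful for `i ∼ j`) -/
  mu : ι → κ → ℝ
  /-- limiting relative pool sizes `ν j` -/
  nu : κ → ℝ
  /-- second order (square root) term of the arrival rates -/
  lamHat : ι → ℝ
  /-- second order term of the service rates -/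
  muHat : ι → κ → ℝ
  /-- second order term of the pool sizes -/
  nuHat : κ → ℝ

namespace NetworkData

variable {ι κ : Type*} (D : NetworkData ι κ)

/-- Adjacency in the bipartite graph of classes and pools. -/
def Adj : ι ⊕ κ → ι ⊕ κ → Prop
  | Sum.inl i, Sum.inr j => D.serves i j
  | Sum.inr j, Sum.inl i => D.serves i j
  | _, _ => False

/-- The bipartite graph on classes and pools, with an edge between `i` and `j` iff `i ∼ j`. -/
def graph : SimpleGraph (ι ⊕ κ) where
  Adj := D.Adj
  symm := ⟨by
    rintro (i | j) (i' | j') h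
    · exact h
    · exact h
    · exact h
    · exact h⟩
  loopless := ⟨by
    rintro (i | j) h
    · exact h
    · exact h⟩

open Classical in
/-- The set of pools that can serve class `i`. -/
def pools [Fintype κ] (i : ι) : Finset κ := {j | D.serves i j}

/-- Feasibility for the static allocation linear program: `ξ ≥ 0`, `ξ i j = 0` for `i ≁ j`, and
`∑ j, μ i j ν j ξ i j = λ i` for all classes `i`. -/
def IsFeasible [Fintype κ] (ξ : ι → κ → ℝ) : Prop :=
  (∀ i j, 0 ≤ ξ i j) ∧ (∀ i j, ¬ D.serves i j → ξ i j = 0) ∧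
    ∀ i, ∑ j, D.mu i j * D.nu j * ξ i j = D.lam i

/-- `ξ` minimizes `max_j ∑_i ξ i j` over the feasible allocations. -/
def IsOptimal [Fintype ι] [Fintype κ] (ξ : ι → κ → ℝ) : Prop :=
  D.IsFeasible ξ ∧ ∀ ξ', D.IsFeasible ξ' → (⨆ j, ∑ i, ξ i j) ≤ ⨆ j, ∑ i, ξ' i j

/-- The factor of one step of a walk: `μ i j` for a step from class `i` to pool `j`,
and `(μ i j)⁻¹` for a step from pool `j` to class `i`. -/
def stepGain : ι ⊕ κ → ι ⊕ κ → ℝ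
  | Sum.inl i, Sum.inr j => D.mu i j
  | Sum.inr j, Sum.inl i => (D.mu i j)⁻¹
  | _, _ => 1

/-- The product of the factors of the steps of a walk. On a walk `i₁, j₁, i₂, j₂, …, i_m` it is
`∏_{k < m} μ (i_k) (j_k) / μ (i_{k+1}) (j_k)`. -/
def walkGain : {u v : ι ⊕ κ} → D.graph.Walk u v → ℝ
  | _, _, SimpleGraph.Walk.nil => 1
  | u, _, SimpleGraph.Walk.cons (v := w) _ p => D.stepGain u w * walkGain p

/-- `z` is a flow on the edges of the graph with class marginals `α` and pool marginals `β`. -/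
def IsFlow [Fintype ι] [Fintype κ] (α : ι → ℝ) (β : κ → ℝ) (z : ι → κ → ℝ) : Prop :=
  (∀ i j, ¬ D.serves i j → z i j = 0) ∧ (∀ i, ∑ j, z i j = α i) ∧ ∀ j, ∑ i, z i j = β j

open Classical in
/-- The map `Ψ`: the solution `z` of `∑ j, z i j = α i`, `∑ i, z i j = β j`, `z i j = 0` for
`i ≁ j`. When the graph is a tree, there is exactly one solution for each pair `(α, β)` whose
entries have equal sums. -/
def Psi [Fintype ι] [Fintype κ] (α : ι → ℝ) (β : κ → ℝ) : ι → κ → ℝ :=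
  if h : ∃ z, D.IsFlow α β z then h.choose else 0

end NetworkData

/-- A multiclass multi-pool network in the Halfin-Whitt regime, whose graph is a tree, under the
complete resource pooling condition. -/
structure ParallelNetwork (ι κ : Type*) [Fintype ι] [Fintype κ] extends NetworkData ι κ where
  lam_pos : ∀ i, 0 < lam i
  nu_pos : ∀ j, 0 < nu j
  mu_pos : ∀ i j, serves i j → 0 < mu i j
  /-- the graph is a tree -/
  isTree : toNetworkData.graph.IsTree
  /-- the solution `ξ*` of the static allocation linear program -/
  xiStar : ι → κ → ℝ
  /-- the linear program has `ξ*` as its unique solution -/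
  isOptimal_iff : ∀ ξ, toNetworkData.IsOptimal ξ ↔ ξ = xiStar
  xiStar_sum : ∀ j, ∑ i, xiStar i j = 1
  xiStar_pos : ∀ i j, serves i j → 0 < xiStar i j

namespace ParallelNetwork

variable {ι κ : Type*} [Fintype ι] [Fintype κ] (N : ParallelNetwork ι κ)

/-- The gain `𝔡(i, l)` between two classes: the product of
`μ (i_k) (j_k) / μ (i_{k+1}) (j_k)` over the unique path `i = i₁, j₁, i₂, …, i_m = l`
(in particular `𝔡(i, i) = 1`). -/
def gain (i l : ι) : ℝ :=
  N.walkGain (N.isTree.existsUnique_path (Sum.inl i) (Sum.inl l)).choose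

/-- `z* i j = ξ* i j ν j`. -/
def zStar (i : ι) (j : κ) : ℝ := N.xiStar i j * N.nu j

/-- The constant term of the drift. -/
def h (i : ι) : ℝ :=
  N.lamHat i - ∑ j ∈ N.pools i, (N.mu i j * N.xiStar i j * N.nuHat j + N.muHat i j * N.zStar i j)

/-- The drift `b(x, u)`, `u = (uc, us)`, of the limiting controlled diffusion:
`b_i(x, u) = h_i - ∑_{j ∼ i} μ i j Ψ_{ij}(x - ⟨e, x⟩⁺ uc, - ⟨e, x⟩⁻ us)`. -/
def drift (x : ι → ℝ) (uc : ι → ℝ) (us : κ → ℝ) (i : ι) : ℝ :=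
  N.h i - ∑ j ∈ N.pools i,
    N.mu i j * N.Psi (x - max (∑ k, x k) 0 • uc) (-(max (-∑ k, x k) 0 • us)) i j

/-- `B₁` and `B₂` are matrices of the drift of the limiting diffusion relative to the pool `j₀`:
`b(x, u) = h - B₁ (x - ⟨e, x⟩⁺ uc) + ⟨e, x⟩⁻ B₂ us` for all `x` and all pairs `u = (uc, us)` of
probability vectors, where the column of `B₂` at `j₀` is zero. -/
def IsDriftMatrices (j₀ : κ) (B₁ : Matrix ι ι ℝ) (B₂ : Matrix ι κ ℝ) : Prop :=
  (∀ x : ι → ℝ, ∀ uc ∈ stdSimplex ℝ ι, ∀ us ∈ stdSimplex ℝ κ,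
    N.drift x uc us =
      N.h - B₁ *ᵥ (x - max (∑ k, x k) 0 • uc) + max (-∑ k, x k) 0 • (B₂ *ᵥ us)) ∧
  ∀ i, B₂ i j₀ = 0

end ParallelNetwork

end

namespace NetworkData

variable {ι κ : Type*} {D : NetworkData ι κ}

/-! On balanced pairs, `Psi` is linear: a flow on a tree is determined by its marginals, and any
marginals can be met by shipping everything from the classes to `j₀` and then from `j₀` to the
pools. Applying the service rates to these basic flows gives B₁ and B₂
(`isDriftMatrices_rateMatrix`). Balance leaves one column vector free, which the zero column at `j₀`
fixes.

Let g(v) be the gain of the path from v to `j₀`. Since g(i) = μ_ij g(j) on every edge, the weights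
p_i = 1/g(i) make p_i μ_ij = 1/g(j) depend on the pool alone. Hence pB₁ only sees the column sums of
the basic flows, and pB₁ = e (`vecMul_rateMatrix`). Once B₁ is known to be invertible
(`isUnit_det_rateMatrix`), eB₁⁻¹ = p > 0, and p_l / p_i = g(i)/g(l) is the gain from i to l. -/

lemma sum_pools_eq [Fintype κ] {z : ι → κ → ℝ} (hz : ∀ i j, ¬ D.serves i j → z i j = 0)
    (c : κ → ℝ) (i : ι) :
    ∑ j ∈ D.pools i, c j * z i j = ∑ j, c j * z i j := by
  classical
  refine Finset.sum_subset (Finset.subset_univ _) fun j _ hj => ?_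
  have : ¬ D.serves i j := by simpa [pools] using hj
  rw [hz i j this, mul_zero]

/-! ### Flows on trees: uniqueness and existence -/

section Flow

variable [Fintype ι] [Fintype κ]

/-- A flow on an acyclic graph all of whose marginals vanish is zero. -/
lemma IsFlow.eq_zero (hD : D.graph.IsAcyclic) {z : ι → κ → ℝ} (hz : D.IsFlow 0 0 z) : z = 0 := by
  classical
  funext i j
  by_cases hij : D.serves i j
  swap
  · exact hz.1 i j hij
  have hadj : D.graph.Adj (Sum.inl i) (Sum.inr j) := hij
  have hbridge := SimpleGraph.isAcyclic_iff_forall_adj_isBridge.1 hD hadj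
  rw [SimpleGraph.isBridge_iff] at hbridge
  set G' := D.graph \ SimpleGraph.fromEdgeSet {s(Sum.inl i, Sum.inr j)} with hG'
  -- Every edge is a bridge. Sum the conservation laws over the side of `i` once the edge `i j` is
  -- deleted: all other edges cancel, leaving `z i j = 0`.
  let χ : ι ⊕ κ → ℝ := fun v => if G'.Reachable (Sum.inl i) v then 1 else 0
  have key : ∑ a, ∑ b, (χ (Sum.inl a) - χ (Sum.inr b)) * z a b = 0 := by
    simp only [sub_mul, Finset.sum_sub_distrib]
    rw [Finset.sum_comm (f := fun a b => χ (Sum.inr b) * z a b)]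
    simp only [← Finset.mul_sum, hz.2.1, hz.2.2]
    simp
  have hterm : ∀ a b, (a ≠ i ∨ b ≠ j) → (χ (Sum.inl a) - χ (Sum.inr b)) * z a b = 0 := by
    intro a b hab
    by_cases hs : D.serves a b
    swap
    · rw [hz.1 a b hs, mul_zero]
    have hadj' : G'.Adj (Sum.inl a) (Sum.inr b) := by
      rw [hG', SimpleGraph.sdiff_adj]
      refine ⟨hs, ?_⟩
      simp only [SimpleGraph.fromEdgeSet_adj, Set.mem_singleton_iff, Sym2.eq_iff]
      rintro ⟨h | h, -⟩
      · rcases hab with hab | hab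
        · exact hab (Sum.inl.inj h.1)
        · exact hab (Sum.inr.inj h.2)
      · exact absurd h.1 (by simp)
    have : χ (Sum.inl a) = χ (Sum.inr b) := by
      have : G'.Reachable (Sum.inl i) (Sum.inl a) ↔ G'.Reachable (Sum.inl i) (Sum.inr b) :=
        ⟨fun h => h.trans hadj'.reachable, fun h => h.trans hadj'.symm.reachable⟩
      simp only [χ, this]
    rw [this, sub_self, zero_mul]
  rw [Finset.sum_eq_single i, Finset.sum_eq_single j] at key
  · have h1 : χ (Sum.inl i) = 1 := if_pos (SimpleGraph.Reachable.refl _)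
    have h2 : χ (Sum.inr j) = 0 := if_neg hbridge
    simpa [h1, h2] using key
  · intro b _ hb
    exact hterm i b (Or.inr hb)
  · simp
  · intro a _ ha
    exact Finset.sum_eq_zero fun b _ => hterm a b (Or.inl ha)
  · simp

lemma IsFlow.sub {α α' : ι → ℝ} {β β' : κ → ℝ} {z z' : ι → κ → ℝ}
    (hz : D.IsFlow α β z) (hz' : D.IsFlow α' β' z') :
    D.IsFlow (α - α') (β - β') (z - z') := by
  refine ⟨fun i j h => ?_, fun i => ?_, fun j => ?_⟩
  · simp [hz.1 i j h, hz'.1 i j h]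
  · simp [hz.2.1, hz'.2.1]
  · simp [hz.2.2, hz'.2.2]

lemma IsFlow.unique (hD : D.graph.IsAcyclic) {α : ι → ℝ} {β : κ → ℝ} {z z' : ι → κ → ℝ}
    (hz : D.IsFlow α β z) (hz' : D.IsFlow α β z') : z = z' := by
  have h := hz.sub hz'
  rw [sub_self, sub_self] at h
  exact sub_eq_zero.1 (h.eq_zero hD)

lemma IsFlow.psi_eq (hD : D.graph.IsAcyclic) {α : ι → ℝ} {β : κ → ℝ} {z : ι → κ → ℝ}
    (hz : D.IsFlow α β z) : D.Psi α β = z := by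
  have h : ∃ z, D.IsFlow α β z := ⟨z, hz⟩
  rw [Psi, dif_pos h]
  exact h.choose_spec.unique hD hz

open Classical in
/-- A walk from `u` to `v` carries a flow with net output `1` at `u` and `-1` at `v`. -/
lemma exists_isFlow_of_walk {u v : ι ⊕ κ} (p : D.graph.Walk u v) :
    ∃ z, D.IsFlow
      (fun i => (Pi.single u 1 - Pi.single v 1 : ι ⊕ κ → ℝ) (Sum.inl i))
      (fun j => (Pi.single v 1 - Pi.single u 1 : ι ⊕ κ → ℝ) (Sum.inr j)) z := by
  induction p with
  | nil => exact ⟨0, by simp [IsFlow]⟩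
  | @cons u w v h p ih =>
    obtain ⟨z, hz⟩ := ih
    rcases u with i | j <;> rcases w with i' | j'
    · exact h.elim
    -- A step from class to pool adds a unit on its edge; a step from pool to class removes one.
    · refine ⟨fun a b => z a b + (if a = i then 1 else 0) * (if b = j' then 1 else 0), ?_, ?_, ?_⟩
      · intro a b hab
        have : ¬ (a = i ∧ b = j') := by rintro ⟨rfl, rfl⟩; exact hab h
        simp only [hz.1 a b hab, zero_add]
        by_cases ha : a = i
        · simp [ha, show b ≠ j' from fun hb => this ⟨ha, hb⟩]
        · simp [ha]
      · intro a
        rw [Finset.sum_add_distrib, hz.2.1]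
        simp [Pi.single_apply]
        ring
      · intro b
        rw [Finset.sum_add_distrib, hz.2.2]
        simp [Pi.single_apply]
    · refine ⟨fun a b => z a b - (if a = i' then 1 else 0) * (if b = j then 1 else 0), ?_, ?_, ?_⟩
      · intro a b hab
        have : ¬ (a = i' ∧ b = j) := by rintro ⟨rfl, rfl⟩; exact hab h
        simp only [hz.1 a b hab, zero_sub]
        by_cases ha : a = i'
        · simp [ha, show b ≠ j from fun hb => this ⟨ha, hb⟩]
        · simp [ha]
      · intro a
        rw [Finset.sum_sub_distrib, hz.2.1]
        simp [Pi.single_apply]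
      · intro b
        rw [Finset.sum_sub_distrib, hz.2.2]
        simp [Pi.single_apply]
    · exact h.elim

open Classical in
/-- On a connected graph, flows with marginals `(e_i, e_{j₀})` and `(0, e_j - e_{j₀})` exist. -/
lemma exists_basic_flows (hD : D.graph.Connected) (j₀ : κ) :
    ∃ (F : ι → ι → κ → ℝ) (G : κ → ι → κ → ℝ),
      (∀ i, D.IsFlow (Pi.single i 1) (Pi.single j₀ 1) (F i)) ∧
      ∀ j, D.IsFlow 0 (Pi.single j 1 - Pi.single j₀ 1) (G j) := by
  have hF : ∀ i, ∃ z, D.IsFlow (Pi.single i 1) (Pi.single j₀ 1) z := by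
    intro i
    obtain ⟨p⟩ := hD.preconnected (Sum.inl i) (Sum.inr j₀)
    obtain ⟨z, hz⟩ := exists_isFlow_of_walk p
    refine ⟨z, hz.1, fun a => ?_, fun b => ?_⟩
    · rw [hz.2.1]; simp [Pi.single_apply]
    · rw [hz.2.2]; simp [Pi.single_apply]
  have hG : ∀ j, ∃ z, D.IsFlow 0 (Pi.single j 1 - Pi.single j₀ 1) z := by
    intro j
    obtain ⟨p⟩ := hD.preconnected (Sum.inr j₀) (Sum.inr j)
    obtain ⟨z, hz⟩ := exists_isFlow_of_walk p
    refine ⟨z, hz.1, fun a => ?_, fun b => ?_⟩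
    · rw [hz.2.1]; simp
    · rw [hz.2.2]; simp [Pi.single_apply]
  choose F hF using hF
  choose G hG using hG
  exact ⟨F, G, hF, hG⟩

open Classical in
-- All class mass goes to `j₀`, and each pool `j` then draws `β j` from there. What remains at `j₀`
-- is `β j₀` because the totals agree.
lemma isFlow_combination {j₀ : κ} {F : ι → ι → κ → ℝ} {G : κ → ι → κ → ℝ}
    (hF : ∀ i, D.IsFlow (Pi.single i 1) (Pi.single j₀ 1) (F i))
    (hG : ∀ j, D.IsFlow 0 (Pi.single j 1 - Pi.single j₀ 1) (G j))
    {α : ι → ℝ} {β : κ → ℝ} (h : ∑ i, α i = ∑ j, β j) :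
    D.IsFlow α β (fun a b => ∑ i, α i * F i a b + ∑ j, β j * G j a b) := by
  refine ⟨fun a b hab => ?_, fun a => ?_, fun b => ?_⟩
  · simp [(hF _).1 a b hab, (hG _).1 a b hab]
  · rw [Finset.sum_add_distrib, Finset.sum_comm, Finset.sum_comm (f := fun b j => β j * G j a b)]
    simp only [← Finset.mul_sum, (hF _).2.1, (hG _).2.1]
    simp [Pi.single_apply]
  · rw [Finset.sum_add_distrib, Finset.sum_comm, Finset.sum_comm (f := fun a j => β j * G j a b)]
    simp only [← Finset.mul_sum, (hF _).2.2, (hG _).2.2]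
    simp only [← Finset.sum_mul, h, Pi.sub_apply, mul_sub, Finset.sum_sub_distrib]
    simp [Pi.single_apply]

end Flow

/-! ### Gains along walks and their potential -/

section Gain

lemma stepGain_pos (hmu : ∀ i j, D.serves i j → 0 < D.mu i j) {u v : ι ⊕ κ}
    (h : D.graph.Adj u v) : 0 < D.stepGain u v := by
  rcases u with i | j <;> rcases v with i' | j'
  · exact h.elim
  · exact hmu _ _ h
  · exact inv_pos.2 (hmu _ _ h)
  · exact h.elim

lemma stepGain_mul_stepGain (hmu : ∀ i j, D.serves i j → 0 < D.mu i j) {u v : ι ⊕ κ}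
    (h : D.graph.Adj u v) : D.stepGain u v * D.stepGain v u = 1 := by
  rcases u with i | j <;> rcases v with i' | j'
  · exact h.elim
  · exact mul_inv_cancel₀ (hmu _ _ h).ne'
  · exact inv_mul_cancel₀ (hmu _ _ h).ne'
  · exact h.elim

lemma walkGain_pos (hmu : ∀ i j, D.serves i j → 0 < D.mu i j) {u v : ι ⊕ κ}
    (p : D.graph.Walk u v) : 0 < D.walkGain p := by
  induction p with
  | nil => exact one_pos
  | cons h p ih => exact mul_pos (stepGain_pos hmu h) ih

lemma walkGain_append {u v w : ι ⊕ κ} (p : D.graph.Walk u v) (q : D.graph.Walk v w) :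
    D.walkGain (p.append q) = D.walkGain p * D.walkGain q := by
  induction p with
  | nil => simp [walkGain]
  | cons h p ih => simp [walkGain, ih, mul_assoc]

/-- Prepending an edge to a path in an acyclic graph multiplies the gain of the path by the gain
of the edge. -/
lemma walkGain_path_of_adj (hmu : ∀ i j, D.serves i j → 0 < D.mu i j)
    (hD : D.graph.IsAcyclic) {u v w : ι ⊕ κ} (h : D.graph.Adj u w) {p : D.graph.Walk u v}
    (hp : p.IsPath) {q : D.graph.Walk w v} (hq : q.IsPath) :
    D.walkGain p = D.stepGain u w * D.walkGain q := by
  classical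
  -- If `q` visits `u`, it must start with the edge from `w` to `u` and continue as `p`; the two
  -- opposite steps have gains with product 1.
  by_cases hu : u ∈ q.support
  · have h1 : q.takeUntil u hu = SimpleGraph.Walk.cons h.symm SimpleGraph.Walk.nil :=
      congrArg Subtype.val ((hD.subsingleton_path _ _).elim ⟨_, hq.takeUntil hu⟩
        ⟨_, SimpleGraph.Walk.IsPath.nil.cons (by simpa using h.ne')⟩)
    have h2 : q.dropUntil u hu = p :=
      congrArg Subtype.val ((hD.subsingleton_path _ _).elim ⟨_, hq.dropUntil hu⟩ ⟨p, hp⟩)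
    rw [← q.take_spec hu, walkGain_append, h1, h2]
    simp only [walkGain, mul_one]
    rw [← mul_assoc, stepGain_mul_stepGain hmu h, one_mul]
  · have h1 : p = SimpleGraph.Walk.cons h q :=
      congrArg Subtype.val ((hD.subsingleton_path _ _).elim ⟨p, hp⟩ ⟨_, hq.cons hu⟩)
    rw [h1, walkGain]

/-- The gains of the paths to a fixed vertex form a potential for the gains of walks. -/
lemma exists_gain_potential (hmu : ∀ i j, D.serves i j → 0 < D.mu i j)
    (hD : D.graph.IsTree) (r : ι ⊕ κ) :
    ∃ g : ι ⊕ κ → ℝ, g r = 1 ∧ (∀ v, 0 < g v) ∧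
      ∀ {u v} (p : D.graph.Walk u v), g u = D.walkGain p * g v := by
  choose P hP _ using fun v => hD.existsUnique_path v r
  refine ⟨fun v => D.walkGain (P v), ?_, fun v => walkGain_pos hmu _, ?_⟩
  · have : P r = SimpleGraph.Walk.nil :=
      congrArg Subtype.val ((hD.isAcyclic.subsingleton_path _ _).elim ⟨_, hP r⟩ ⟨_, SimpleGraph.Walk.IsPath.nil⟩)
    simp only [this, walkGain]
  · intro u v p
    induction p with
    | nil => simp [walkGain]
    | cons h p ih =>
      rw [walkGain, mul_assoc, ← ih]
      exact walkGain_path_of_adj hmu hD.isAcyclic h (hP _) (hP _)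

end Gain

end NetworkData

/-! ### The drift matrices and the invertibility of B₁ -/

namespace ParallelNetwork

open NetworkData

variable {ι κ : Type*} [Fintype ι] [Fintype κ] {N : ParallelNetwork ι κ}

lemma nonempty_classes (N : ParallelNetwork ι κ) (j₀ : κ) : Nonempty ι := by
  by_contra h
  rw [not_nonempty_iff] at h
  simpa using N.xiStar_sum j₀

/-- The matrix with entries `∑ j, μ k j F c k j` formed from a family of flows `F`. -/
def rateMatrix (N : ParallelNetwork ι κ) {γ : Type*} (F : γ → ι → κ → ℝ) : Matrix ι γ ℝ :=
  Matrix.of fun k c => ∑ j, N.mu k j * F c k j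

lemma rateMatrix_mulVec {γ : Type*} [Fintype γ] (F : γ → ι → κ → ℝ) (a : γ → ℝ) (k : ι) :
    (N.rateMatrix F *ᵥ a) k = ∑ j, N.mu k j * ∑ c, a c * F c k j := by
  simp only [rateMatrix, Matrix.mulVec, dotProduct, Matrix.of_apply, Finset.sum_mul,
    Finset.mul_sum]
  rw [Finset.sum_comm]
  exact Finset.sum_congr rfl fun _ _ => Finset.sum_congr rfl fun _ _ => by ring

open Classical in
lemma isDriftMatrices_rateMatrix {j₀ : κ} {F : ι → ι → κ → ℝ} {G : κ → ι → κ → ℝ}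
    (hF : ∀ i, N.IsFlow (Pi.single i 1) (Pi.single j₀ 1) (F i))
    (hG : ∀ j, N.IsFlow 0 (Pi.single j 1 - Pi.single j₀ 1) (G j)) :
    N.IsDriftMatrices j₀ (N.rateMatrix F) (N.rateMatrix G) := by
  constructor
  · intro x uc huc us hus
    funext k
    set s := ∑ k, x k with hs
    -- Balance of the two arguments of `Psi` is the identity s - s⁺ = -s⁻.
    have hsum : ∑ i, (x - max s 0 • uc) i = ∑ j, (-(max (-s) 0 • us)) j := by
      simp only [Pi.sub_apply, Pi.neg_apply, Pi.smul_apply, smul_eq_mul, Finset.sum_sub_distrib,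
        Finset.sum_neg_distrib, ← Finset.mul_sum, huc.2, hus.2, ← hs]
      rcases le_total 0 s with h | h
      · simp [h]
      · simp [h]
    have hflow := isFlow_combination hF hG hsum
    rw [drift, hflow.psi_eq N.isTree.isAcyclic, sum_pools_eq hflow.1]
    simp only [mul_add, Finset.sum_add_distrib]
    rw [← rateMatrix_mulVec, ← rateMatrix_mulVec, Matrix.mulVec_neg, Matrix.mulVec_smul]
    simp only [Pi.add_apply, Pi.sub_apply, Pi.neg_apply]
    ring
  · intro k
    have h0 : G j₀ = 0 := by
      refine IsFlow.eq_zero N.isTree.isAcyclic ?_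
      simpa using hG j₀
    simp [rateMatrix, h0]

/-- At x = -eᵢ, uᶜ = eᵢ, uˢ = eⱼ one has s⁺ = 0 and s⁻ = 1, so the drift reads off column i of B₁
plus column j of B₂. Taking j = `j₀` isolates B₁. -/
lemma IsDriftMatrices.unique {j₀ : κ} {B₁ B₁' : Matrix ι ι ℝ} {B₂ B₂' : Matrix ι κ ℝ}
    (h : N.IsDriftMatrices j₀ B₁ B₂) (h' : N.IsDriftMatrices j₀ B₁' B₂') :
    B₁ = B₁' ∧ B₂ = B₂' := by
  classical
  have hval : ∀ {C₁ : Matrix ι ι ℝ} {C₂ : Matrix ι κ ℝ}, N.IsDriftMatrices j₀ C₁ C₂ →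
      ∀ (i : ι) (j : κ) (k : ι),
        N.drift (-Pi.single i 1) (Pi.single i 1) (Pi.single j 1) k = N.h k + C₁ k i + C₂ k j := by
    intro C₁ C₂ hC i j k
    rw [hC.1 _ _ (single_mem_stdSimplex ℝ i) _ (single_mem_stdSimplex ℝ j)]
    simp [Matrix.mulVec_neg]
  have h1 : B₁ = B₁' := by
    ext k i
    have e := hval h i j₀ k
    rw [hval h' i j₀ k, h.2, h'.2] at e
    linarith
  refine ⟨h1, ?_⟩
  ext k j
  obtain ⟨i⟩ := N.nonempty_classes j₀
  have e := hval h i j k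
  rw [hval h' i j k, h1] at e
  linarith

/-- A vector `p` for which `p i * μ i j` depends only on `j` satisfies `p B₁ = c j₀ e`. -/
lemma vecMul_rateMatrix [DecidableEq ι] [DecidableEq κ] {j₀ : κ} {F : ι → ι → κ → ℝ}
    (hF : ∀ i, N.IsFlow (Pi.single i 1) (Pi.single j₀ 1) (F i)) {p : ι → ℝ} {c : κ → ℝ}
    (hp : ∀ i j, N.serves i j → p i * N.mu i j = c j) (i : ι) :
    (p ᵥ* N.rateMatrix F) i = c j₀ := by
  have hterm : ∀ k j, p k * (N.mu k j * F i k j) = c j * F i k j := by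
    intro k j
    by_cases h : N.serves k j
    · rw [← mul_assoc, hp k j h]
    · simp [(hF i).1 k j h]
  simp only [rateMatrix, Matrix.vecMul, dotProduct, Matrix.of_apply, Finset.mul_sum, hterm]
  rw [Finset.sum_comm]
  simp only [← Finset.mul_sum, (hF i).2.2]
  simp [Pi.single_apply]

/-- If B₁x = 0, pairing with p gives ∑ x = 0, so the flow z with row sums x has zero column sums.
Rescaling z by p_a μ_ab kills its row sums too, and a tree carries no such nonzero flow. -/
lemma isUnit_det_rateMatrix [DecidableEq ι] [DecidableEq κ] {j₀ : κ} {F : ι → ι → κ → ℝ}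
    (hF : ∀ i, N.IsFlow (Pi.single i 1) (Pi.single j₀ 1) (F i)) {p : ι → ℝ} {c : κ → ℝ}
    (hp : ∀ i j, N.serves i j → p i * N.mu i j = c j) (hp0 : ∀ i, 0 < p i) (hc : c j₀ = 1) :
    IsUnit (N.rateMatrix F).det := by
  rw [← Matrix.isUnit_iff_isUnit_det, ← Matrix.mulVec_injective_iff_isUnit]
  refine (injective_iff_map_eq_zero (N.rateMatrix F).mulVecLin).2 fun x hx => ?_
  rw [Matrix.mulVecLin_apply] at hx
  have hsum : ∑ i, x i = 0 := by
    have h : p ⬝ᵥ (N.rateMatrix F *ᵥ x) = ∑ i, x i := by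
      rw [Matrix.dotProduct_mulVec]
      simp [dotProduct, vecMul_rateMatrix hF hp, hc]
    rw [← h, hx, dotProduct_zero]
  set z : ι → κ → ℝ := fun a b => ∑ i, x i * F i a b with hz
  have hz0 : ∀ a b, ¬ N.serves a b → z a b = 0 := fun a b hab => by
    simp [hz, (hF _).1 a b hab]
  have hrow : ∀ a, ∑ b, z a b = x a := fun a => by
    rw [hz, Finset.sum_comm]
    simp only [← Finset.mul_sum, (hF _).2.1]
    simp [Pi.single_apply]
  have hcol : ∀ b, ∑ a, z a b = 0 := fun b => by
    rw [hz, Finset.sum_comm]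
    simp only [← Finset.mul_sum, (hF _).2.2, ← Finset.sum_mul, hsum, zero_mul]
  have hflow : N.IsFlow 0 0 (fun a b => p a * (N.mu a b * z a b)) := by
    refine ⟨fun a b hab => by simp [hz0 a b hab], fun a => ?_, fun b => ?_⟩
    · rw [← Finset.mul_sum, ← rateMatrix_mulVec, hx]
      simp
    -- Within a column the rescaling factor is the constant `c b`, so zero column sums survive.
    · have : ∀ a, p a * (N.mu a b * z a b) = c b * z a b := by
        intro a
        by_cases h : N.serves a b
        · rw [← mul_assoc, hp a b h]
        · simp [hz0 a b h]
      simp only [this, ← Finset.mul_sum, hcol, mul_zero, Pi.zero_apply]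
  have hzero := hflow.eq_zero N.isTree.isAcyclic
  funext a
  rw [← hrow a, Pi.zero_apply]
  refine Finset.sum_eq_zero fun b _ => ?_
  by_cases h : N.serves a b
  · have := congrFun (congrFun hzero a) b
    simpa [(hp0 a).ne', (N.mu_pos a b h).ne'] using this
  · exact hz0 a b h

end ParallelNetwork

open NetworkData ParallelNetwork in
theorem theorem3 {ι κ : Type*} [Fintype ι] [Fintype κ] [DecidableEq ι]
    (N : ParallelNetwork ι κ) (j₀ : κ) :
    (∃! B : Matrix ι ι ℝ × Matrix ι κ ℝ, N.IsDriftMatrices j₀ B.1 B.2) ∧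
    ∀ (B₁ : Matrix ι ι ℝ) (B₂ : Matrix ι κ ℝ), N.IsDriftMatrices j₀ B₁ B₂ →
      IsUnit B₁.det ∧
      (∀ i l : ι, N.gain i l = ((1 : ι → ℝ) ᵥ* B₁⁻¹) l / ((1 : ι → ℝ) ᵥ* B₁⁻¹) i) ∧
      ∀ i : ι, 0 < ((1 : ι → ℝ) ᵥ* B₁⁻¹) i := by
  classical
  obtain ⟨F, G, hF, hG⟩ := exists_basic_flows N.isTree.connected j₀
  -- Same flows, with the given decidable equality on `ι` in place of the classical one.
  have hF' : ∀ i, N.IsFlow (Pi.single i 1) (Pi.single j₀ 1) (F i) := fun i => by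
    convert hF i
  have hB : N.IsDriftMatrices j₀ (N.rateMatrix F) (N.rateMatrix G) :=
    isDriftMatrices_rateMatrix hF hG
  refine ⟨⟨(N.rateMatrix F, N.rateMatrix G), hB, fun B' hB' => ?_⟩, fun B₁ B₂ h => ?_⟩
  · exact Prod.ext (hB'.unique hB).1 (hB'.unique hB).2
  obtain rfl := (h.unique hB).1
  obtain ⟨g, hg1, hgpos, hg⟩ := exists_gain_potential N.mu_pos N.isTree (Sum.inr j₀)
  have hp : ∀ i j, N.serves i j → (g (Sum.inl i))⁻¹ * N.mu i j = (g (Sum.inr j))⁻¹ := by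
    intro i j hij
    have hadj : N.graph.Adj (Sum.inl i) (Sum.inr j) := hij
    have e : g (Sum.inl i) = N.mu i j * g (Sum.inr j) := by
      simpa [walkGain, stepGain] using hg (SimpleGraph.Walk.cons hadj SimpleGraph.Walk.nil)
    have := (N.mu_pos i j hij).ne'
    have := (hgpos (Sum.inr j)).ne'
    rw [e]
    field_simp
  have hc : (g (Sum.inr j₀))⁻¹ = 1 := by rw [hg1, inv_one]
  have hunit := isUnit_det_rateMatrix (p := fun i => (g (Sum.inl i))⁻¹)
    (c := fun j => (g (Sum.inr j))⁻¹) hF' hp (fun i => inv_pos.2 (hgpos _)) hc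
  have hone : (1 : ι → ℝ) ᵥ* (N.rateMatrix F)⁻¹ = fun i => (g (Sum.inl i))⁻¹ := by
    have e : (fun i => (g (Sum.inl i))⁻¹) ᵥ* N.rateMatrix F = 1 := by
      funext i
      rw [vecMul_rateMatrix (c := fun j => (g (Sum.inr j))⁻¹) hF' hp i]
      exact hc
    rw [← e, Matrix.vecMul_vecMul, Matrix.mul_nonsing_inv _ hunit, Matrix.vecMul_one]
  refine ⟨hunit, fun i l => ?_, fun i => ?_⟩
  · have e : g (Sum.inl i) = N.gain i l * g (Sum.inl l) := hg _
    simp only [hone]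
    rw [e, inv_div_inv, mul_div_cancel_right₀ _ (hgpos (Sum.inl l)).ne']
  · rw [hone]
    exact inv_pos.2 (hgpos _)
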